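/- Let $l\in\mathbb N$ and let $v_1,\dots,v_l$ be nonconstant real analytic functions on $\mathbb T=\mathbb R/\mathbb Z$; write $V=\mathrm{diag}(v_1,\dots,v_l)$. For $t>0$ let $$\mathrm{DC}_t=\Big\{\omega\in\mathbb R:\ \|k\omega\|_{\mathbb T}\ge \frac{t}{|k|^2}\ \text{ for all } k\in\mathbb Z\setminus\{0\}\Big\},\qquad \|x\|_{\mathbb T}=\min_{m\in\mathbb Z}|x-m|.$$ For $\epsilon>0$, $\omega,x\in\mathbb R$ and complex $l\times l$ matrices $(W_k)_{k\in\mathbb Z}$ let $H(x)$ be the operator $$(H(x)\vec\psi)_n=\epsilon\sum_{k\in\mathbb Z}W_k\vec\psi_{n-k}+V(x+n\omega)\vec\psi_n,\qquad \vec\psi\in\ell^2(\mathbb Z,\mathbb C^l).$$ For $N\ge 1$ let $H_N(x)$ be the $Nl\times Nl$ matrix of its restriction to the sites $1,\dots,N$. The scalar indices $1\le\gamma\le Nl$ are written $\gamma=l(n(\gamma)-1)+r$ with $1\le r\le l$ and $1\le n(\gamma)\le N$. Let $\mu_{N,(\alpha,\alpha')}(x,E)$ be the determinant of the matrix obtained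 from $H_N(x)-E I$ by deleting row $\alpha$ and column $\alpha'$. Then there is $\sigma>0$, depending only on $V$, such that for every $\rho>0$ there is $\epsilon_0>0$, depending only on $V,l,\rho$, with the following property. For all $0<\epsilon\le\epsilon_0$ and $t>0$ there is $N_0$, depending only on $V,l,\rho,\epsilon,t$, such that for all $\omega\in\mathrm{DC}_t$, all $(W_k)_{k\in\mathbb Z}$ with $W_{-k}=W_k^*$ (the conjugate transpose) and $\|W_k\|\le e^{-\rho|k|}$ (operator norm for the Euclidean norm) for every $k$, all $N\ge N_0$, all $x\in\mathbb T$, all $E\in\mathbb R$ and all $1\le\alpha,\alpha'\le Nl$, $$|\mu_{N,(\alpha,\alpha')}(x,E)|\le \exp\Big(N\Big(\sum_{j=1}^l\int_{\mathbb T}\log|v_j(y)-E|\,dy+l\epsilon^{\sigma}\Big)\Big)\,e^{-(\rho-\epsilon^{\sigma})|n(\alpha)-n(\alpha')|}.$$ -/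

import Mathlib

noncomputable section

namespace QPBlock

/-- Distance of a real number to the nearest integer, the norm on `ℝ / ℤ`. -/
def torusNorm (x : ℝ) : ℝ := |x - (round x : ℝ)|

/-- The Diophantine frequencies `DC_t`. -/
def DC (t : ℝ) : Set ℝ :=
  {ω : ℝ | ∀ k : ℤ, k ≠ 0 → t / |(k : ℝ)| ^ 2 ≤ torusNorm ((k : ℝ) * ω)}

/-- A real analytic function on the torus `ℝ / ℤ`, as a function on `ℝ` of period `1`. -/
def IsAnalyticOnTorus (v : ℝ → ℝ) : Prop :=
  Function.Periodic v 1 ∧ ∀ x : ℝ, AnalyticAt ℝ v x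

/-- The function is not constant. -/
def Nonconstant (v : ℝ → ℝ) : Prop := ¬ ∃ c : ℝ, ∀ x : ℝ, v x = c

/-- The logarithm in the averages `∫ log |v - E|` is integrable, so these integrals have their
usual meaning. -/
theorem log_intervalIntegrable (v : ℝ → ℝ) (hv : IsAnalyticOnTorus v) (E : ℝ) :
    IntervalIntegrable (fun y => Real.log |v y - E|) MeasureTheory.volume 0 1 := by
  have h : MeromorphicOn (fun y => v y - E) (Set.uIcc 0 1) := fun y _ =>
    ((hv.2 y).sub analyticAt_const).meromorphicAt
  simpa [Real.norm_eq_abs] using h.intervalIntegrable_log_norm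

/-- Operator norm of a complex matrix with respect to the Euclidean norms. -/
def opNorm {l : ℕ} (A : Matrix (Fin l) (Fin l) ℂ) : ℝ :=
  ‖Matrix.toEuclideanCLM (n := Fin l) (𝕜 := ℂ) A‖

/-- The `l × l` block in position `(n, n')` of the operator
`(H ψ)_n = ε ∑_k W_k ψ_{n-k} + V(x + n ω) ψ_n` on `ℓ²(ℤ, ℂ^l)`, `V = diag (v_1, …, v_l)`. -/
def block {l : ℕ} (v : Fin l → ℝ → ℝ) (W : ℤ → Matrix (Fin l) (Fin l) ℂ) (ε ω x : ℝ)
    (n n' : ℤ) : Matrix (Fin l) (Fin l) ℂ :=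
  (ε : ℂ) • W (n - n') +
    if n = n' then Matrix.diagonal (fun j => ((v j (x + (n : ℝ) * ω) : ℝ) : ℂ)) else 0

/-- The site `n(γ) ∈ {1, …, N}` of a scalar index. The index `γ : Fin (N * l)` is zero-based: it
stands for the scalar index `γ + 1 = l (n(γ) - 1) + r` with `1 ≤ r ≤ l`. -/
def site {N l : ℕ} (γ : Fin (N * l)) : ℤ := ((γ.divNat : ℕ) : ℤ) + 1

/-- The matrix `H_N(x)`, the restriction of the operator to the sites `1, …, N`, with scalar
indices. -/
def dirichlet {l : ℕ} (v : Fin l → ℝ → ℝ) (W : ℤ → Matrix (Fin l) (Fin l) ℂ) (ε ω x : ℝ)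
    (N : ℕ) : Matrix (Fin (N * l)) (Fin (N * l)) ℂ :=
  Matrix.of fun γ γ' => block v W ε ω x (site γ) (site γ') γ.modNat γ'.modNat

/-- The increasing enumeration of all indices different from `γ`. -/
def omit1 {m : ℕ} (γ : Fin m) : Fin (m - 1) ↪o Fin m :=
  (({γ} : Finset (Fin m))ᶜ).orderEmbOfFin (by simp [Finset.card_compl])

/-- The `(α, α')`-minor: the determinant after deleting row `α` and column `α'`. -/
def minor {m : ℕ} (A : Matrix (Fin m) (Fin m) ℂ) (α α' : Fin m) : ℂ :=
  (A.submatrix (omit1 α) (omit1 α')).det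

end QPBlock

end

namespace QPBlock

/-! ### Sublevel sets and smoothed logarithmic averages, uniformly in the energy. -/

section

open MeasureTheory Set Filter Topology
open scoped ContDiff

/-! A determinant is at most the product of its ℓ¹ row sums. Conjugating the matrix by weights
`e^{w}`, with `w` linear in the site of slope ±(ρ - δ), multiplies the minor by
`e^{(ρ-δ)|n(α)-n(α')|}` and still leaves off-diagonal entries of size `ε e^{-δ|n-n'|}`. The row at
site `n` and component `j` then sums to at most `|v_j(x+nω) - E| + η` with `η = 4lε/δ`
(`norm_minor_dirichlet_le`). So the decay is exact, and the prefactor is the exponential of Birkhoff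
sums of `log(|v_j - E| + η)`, minus `log η` for the deleted row.

Two facts about this smoothed logarithm finish the proof. For fixed `η` it is Lipschitz with a
constant independent of `E`, so Diophantine equidistribution is uniform in `x`, `ω` and `E`
(`exists_sum_orbit_le`). Its mean exceeds that of `log|v_j - E|` by at most `C η^a`, uniformly in
`E` (`exists_integral_log_add_le`). The latter rests on a bound for the sublevel sets of `v - E`:
some derivative of positive order is nonzero at each point, and such derivatives do not see `E`.
Finally `δ = ε^{a/4}`, so that `η^a` is much smaller than `δ`. -/

theorem iteratedDeriv_sub_const_of_pos {k : ℕ} (hk : 0 < k) (v : ℝ → ℝ) (E y : ℝ) :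
    iteratedDeriv k (fun z => v z - E) y = iteratedDeriv k v y := by
  obtain ⟨k, rfl⟩ := Nat.exists_eq_succ_of_ne_zero hk.ne'
  rw [Nat.succ_eq_add_one, iteratedDeriv_succ', iteratedDeriv_succ']
  congr 1
  funext z
  exact deriv_sub_const E

/-- The sublevel set estimate for a function one of whose derivatives is bounded below. -/
theorem volume_sublevel_le (k : ℕ) : ∀ (g : ℝ → ℝ), ContDiff ℝ ∞ g → ∀ I : Set ℝ, I.OrdConnected →
    ∀ c δ : ℝ, 0 < c → 0 < δ → (∀ y ∈ I, c ≤ iteratedDeriv k g y) →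
    volume (I ∩ {y | |g y| < c * δ ^ k}) ≤ ENNReal.ofReal ((2 ^ (k + 1) - 2) * δ) := by
  induction k with
  | zero =>
    intro g _ I _ c δ hc hδ h
    have : I ∩ {y | |g y| < c * δ ^ 0} = ∅ := by
      ext y
      simp only [mem_inter_iff, mem_ofPred_eq, mem_empty_iff_false, iff_false, not_and, not_lt]
      intro hy
      have := h y hy
      simp only [iteratedDeriv_zero] at this
      simpa using this.trans (le_abs_self _)
    rw [this]; simp
  | succ k ih =>
    intro g hg I hI c δ hc hδ h
    set f := iteratedDeriv k g with hf
    have hfd : Differentiable ℝ f := hg.differentiable_iteratedDeriv k (by exact_mod_cast WithTop.coe_lt_top _)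
    have hmono : ∀ x ∈ I, ∀ y ∈ I, x ≤ y → c * (y - x) ≤ f y - f x := by
      refine hI.convex.mul_sub_le_image_sub_of_le_deriv hfd.continuous.continuousOn
        hfd.differentiableOn fun x hx => ?_
      have := h x (interior_subset hx)
      rwa [iteratedDeriv_succ] at this
    have hle : ∀ x ∈ I, ∀ y ∈ I, x ≤ y → f x ≤ f y := fun x hx y hy hxy => by
      have := hmono x hx y hy hxy
      nlinarith [mul_nonneg hc.le (sub_nonneg.2 hxy)]
    have hcδ : 0 < c * δ := mul_pos hc hδ
    -- Since `f` is monotone on `I`, the regions `f ≥ cδ` and `f ≤ -cδ` are order-connected and the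
    -- induction applies to `g` and `-g` there. On the rest `f` varies by less than `2cδ` at slope
    -- at least `c`, so the diameter is at most `2δ`. Hence the recursion `a_{k+1} = 2 a_k + 2`,
    -- `a_0 = 0`, for the constant.
    have h1 := ih g hg (I ∩ {y | c * δ ≤ f y})
      ⟨fun x hx y hy z hz => ⟨hI.out hx.1 hy.1 hz,
        hx.2.trans (hle x hx.1 z (hI.out hx.1 hy.1 hz) hz.1)⟩⟩ (c * δ) δ hcδ hδ (fun y hy => hy.2)
    have h2 := ih (-g) hg.neg (I ∩ {y | f y ≤ -(c * δ)})
      ⟨fun x hx y hy z hz => ⟨hI.out hx.1 hy.1 hz,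
        (hle z (hI.out hx.1 hy.1 hz) y hy.1 hz.2).trans hy.2⟩⟩ (c * δ) δ hcδ hδ (fun y hy => by
          rw [iteratedDeriv_neg]; have := hy.2; simp only [mem_ofPred_eq] at this; linarith)
    have h3 : volume (I ∩ {y | |f y| < c * δ}) ≤ ENNReal.ofReal (2 * δ) := by
      refine (Real.volume_le_diam _).trans (Metric.ediam_le fun x hx y hy => ?_)
      rw [edist_dist]
      refine ENNReal.ofReal_le_ofReal ?_
      have hx2 := abs_lt.1 (show |f x| < c * δ from hx.2)
      have hy2 := abs_lt.1 (show |f y| < c * δ from hy.2)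
      rw [Real.dist_eq, abs_le]
      rcases le_total x y with hxy | hxy
      · have := hmono x hx.1 y hy.1 hxy
        constructor <;> nlinarith
      · have := hmono y hy.1 x hx.1 hxy
        constructor <;> nlinarith
    have hpow : (0 : ℝ) ≤ 2 ^ (k + 1) - 2 := by
      have : (1 : ℝ) ≤ 2 ^ k := one_le_pow₀ (by norm_num)
      rw [pow_succ]; linarith
    have hsub : I ∩ {y | |g y| < c * δ ^ (k + 1)} ⊆
        (I ∩ {y | c * δ ≤ f y}) ∩ {y | |g y| < c * δ * δ ^ k} ∪
        ((I ∩ {y | f y ≤ -(c * δ)}) ∩ {y | |(-g) y| < c * δ * δ ^ k} ∪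
          I ∩ {y | |f y| < c * δ}) := by
      rintro y ⟨hy, hy'⟩
      have e : c * δ ^ (k + 1) = c * δ * δ ^ k := by ring
      simp only [mem_ofPred_eq, e] at hy'
      rcases le_or_gt (c * δ) (f y) with h | h
      · exact Or.inl ⟨⟨hy, h⟩, hy'⟩
      · rcases le_or_gt (f y) (-(c * δ)) with h' | h'
        · exact Or.inr (Or.inl ⟨⟨hy, h'⟩, by simpa using hy'⟩)
        · exact Or.inr (Or.inr ⟨hy, abs_lt.2 ⟨h', h⟩⟩)
    calc _ ≤ ENNReal.ofReal ((2 ^ (k + 1) - 2) * δ) +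
          (ENNReal.ofReal ((2 ^ (k + 1) - 2) * δ) + ENNReal.ofReal (2 * δ)) :=
        (measure_mono hsub).trans ((measure_union_le _ _).trans
          (add_le_add h1 ((measure_union_le _ _).trans (add_le_add h2 h3))))
      _ = _ := by
        rw [← ENNReal.ofReal_add (by positivity) (by positivity),
          ← ENNReal.ofReal_add (by positivity) (by positivity)]
        congr 1; ring

/-- Otherwise `v - v y` vanishes to infinite order at `y`, and the identity theorem makes `v`
constant. -/
theorem exists_iteratedDeriv_ne_zero {v : ℝ → ℝ} (hv : ∀ x, AnalyticAt ℝ v x)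
    (hv' : Nonconstant v) (y : ℝ) : ∃ k : ℕ, 0 < k ∧ iteratedDeriv k v y ≠ 0 := by
  by_contra! hcon
  apply hv'
  refine ⟨v y, fun x => ?_⟩
  have han : AnalyticAt ℝ (fun z => v z - v y) y := (hv y).sub analyticAt_const
  have htop : analyticOrderAt (fun z => v z - v y) y = ⊤ := by
    rw [ENat.eq_top_iff_forall_ge]
    intro n
    rw [natCast_le_analyticOrderAt_iff_iteratedDeriv_eq_zero han]
    intro i _
    rcases Nat.eq_zero_or_pos i with rfl | hi
    · simp
    · rw [iteratedDeriv_sub_const_of_pos hi]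
      exact hcon i hi
  rw [analyticOrderAt_eq_top] at htop
  have : v = fun _ => v y := AnalyticOnNhd.eq_of_eventuallyEq (𝕜 := ℝ) (z₀ := y)
    (fun z _ => hv z) (fun z _ => analyticAt_const) (htop.mono fun z hz => by
      simpa [sub_eq_zero] using hz)
  exact congrFun this x

/-- The sublevel sets of `v - E` on `S` are of size `O(s ^ κ)` for some `κ > 0`, uniformly
in `E`. -/
def SublevelBound (v : ℝ → ℝ) (S : Set ℝ) : Prop :=
  ∃ κ C : ℝ, 0 < κ ∧ 0 ≤ C ∧ ∀ E s : ℝ, 0 < s → s ≤ 1 →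
    volume (S ∩ {y | |v y - E| < s}) ≤ ENNReal.ofReal (C * s ^ κ)

theorem SublevelBound.union {v : ℝ → ℝ} {S T : Set ℝ} (hS : SublevelBound v S)
    (hT : SublevelBound v T) : SublevelBound v (S ∪ T) := by
  obtain ⟨κ, C, hκ, hC, h⟩ := hS
  obtain ⟨κ', C', hκ', hC', h'⟩ := hT
  refine ⟨min κ κ', C + C', lt_min hκ hκ', by positivity, fun E s hs hs1 => ?_⟩
  rw [union_inter_distrib_right, add_mul, ENNReal.ofReal_add (by positivity) (by positivity)]
  refine (measure_union_le _ _).trans (add_le_add ((h E s hs hs1).trans ?_)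
    ((h' E s hs hs1).trans ?_))
  · exact ENNReal.ofReal_le_ofReal (mul_le_mul_of_nonneg_left
      (Real.rpow_le_rpow_of_exponent_ge hs hs1 (min_le_left _ _)) hC)
  · exact ENNReal.ofReal_le_ofReal (mul_le_mul_of_nonneg_left
      (Real.rpow_le_rpow_of_exponent_ge hs hs1 (min_le_right _ _)) hC')

theorem sublevelBound_of_le_iteratedDeriv {v : ℝ → ℝ} (hv : ContDiff ℝ ∞ v) {I : Set ℝ}
    (hI : I.OrdConnected) {k : ℕ} (hk : 0 < k) {c : ℝ} (hc : 0 < c)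
    (h : ∀ y ∈ I, c ≤ iteratedDeriv k v y) : SublevelBound v I := by
  refine ⟨(k : ℝ)⁻¹, (2 ^ (k + 1) - 2) * (c⁻¹) ^ (k : ℝ)⁻¹, by positivity, ?_,
    fun E s hs _ => ?_⟩
  · have : (1 : ℝ) ≤ 2 ^ k := one_le_pow₀ (by norm_num)
    have : (0 : ℝ) ≤ 2 ^ (k + 1) - 2 := by rw [pow_succ]; linarith
    positivity
  have hδ : 0 < (c⁻¹ * s) ^ (k : ℝ)⁻¹ := by positivity
  have := volume_sublevel_le k (fun y => v y - E) (hv.sub contDiff_const) I hI c _ hc hδ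
    (fun y hy => by rw [iteratedDeriv_sub_const_of_pos hk]; exact h y hy)
  rw [Real.rpow_inv_natCast_pow (by positivity) hk.ne', mul_inv_cancel_left₀ hc.ne',
    Real.mul_rpow (by positivity) hs.le, ← mul_assoc] at this
  exact this

theorem SublevelBound.of_neg {v : ℝ → ℝ} {S : Set ℝ} (h : SublevelBound (-v) S) :
    SublevelBound v S := by
  obtain ⟨κ, C, hκ, hC, h⟩ := h
  refine ⟨κ, C, hκ, hC, fun E s hs hs1 => ?_⟩
  have e : ∀ y, |(-v) y - -E| = |v y - E| := fun y => by rw [Pi.neg_apply, ← neg_sub', abs_neg]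
  simpa only [e] using h (-E) s hs hs1

theorem sublevelBound_unitInterval {v : ℝ → ℝ} (hv : ∀ x, AnalyticAt ℝ v x)
    (hv' : Nonconstant v) : SublevelBound v (Icc 0 1) := by
  have hcd : ContDiff ℝ ∞ v := AnalyticOnNhd.contDiff fun x _ => hv x
  refine isCompact_Icc.induction_on (p := SublevelBound v) ?_ ?_ (fun s t => SublevelBound.union) ?_
  · exact ⟨1, 0, one_pos, le_rfl, by simp⟩
  · rintro s t hst ⟨κ, C, hκ, hC, h⟩
    exact ⟨κ, C, hκ, hC, fun E s hs hs1 =>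
      (measure_mono (inter_subset_inter_left _ hst)).trans (h E s hs hs1)⟩
  · intro y _
    obtain ⟨k, hk, hne⟩ := exists_iteratedDeriv_ne_zero hv hv' y
    have key : ∀ w : ℝ → ℝ, ContDiff ℝ ∞ w → 0 < iteratedDeriv k w y →
        ∃ t ∈ 𝓝 y, SublevelBound w t := by
      intro w hw hpos
      have hcont : Continuous (iteratedDeriv k w) :=
        hw.continuous_iteratedDeriv k (by exact_mod_cast le_top)
      have hev := hcont.continuousAt.eventually_const_lt (half_lt_self hpos)
      obtain ⟨r, hr, hball⟩ := Metric.eventually_nhds_iff_ball.1 hev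
      refine ⟨Metric.ball y r, Metric.ball_mem_nhds y hr,
        sublevelBound_of_le_iteratedDeriv hw ?_ hk (half_pos hpos) fun z hz => (hball z hz).le⟩
      rw [Real.ball_eq_Ioo]; exact ordConnected_Ioo
    rcases lt_or_gt_of_ne hne with h | h
    · obtain ⟨t, ht, hb⟩ := key (-v) hcd.neg (by rw [iteratedDeriv_neg]; linarith)
      exact ⟨t, mem_nhdsWithin_of_mem_nhds ht, hb.of_neg⟩
    · obtain ⟨t, ht, hb⟩ := key v hcd h
      exact ⟨t, mem_nhdsWithin_of_mem_nhds ht, hb⟩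

/-- Negative moments of `v - E` are bounded uniformly in `E`. -/
theorem exists_lintegral_rpow_neg_le {v : ℝ → ℝ} (hv : ∀ x, AnalyticAt ℝ v x)
    (hv' : Nonconstant v) : ∃ a C : ℝ, 0 < a ∧ a ≤ 1 ∧ 0 ≤ C ∧ ∀ E : ℝ,
      ∫⁻ y in Icc (0 : ℝ) 1, ENNReal.ofReal (|v y - E| ^ (-a)) ≤ ENNReal.ofReal C := by
  obtain ⟨κ, C, hκ, hC, h⟩ := sublevelBound_unitInterval hv hv'
  have hcont : Continuous v := continuous_iff_continuousAt.2 fun x => (hv x).continuousAt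
  -- In the layer-cake formula the level `τ > 1` contributes at most `C τ^{-κ/a}`; `a ≤ κ/2` makes
  -- this at most `C τ^{-2}`, which is integrable.
  set a := min (κ / 2) 1 with ha
  have hmeas : ∀ E, Measurable fun y => |v y - E| ^ (-a) := fun E =>
    (show Continuous fun y => |v y - E| by fun_prop).measurable.pow_const _
  have ha0 : 0 < a := by positivity
  have haκ : a ≤ κ / 2 := min_le_left _ _
  set B := ∫⁻ τ in Ioi (1 : ℝ), ENNReal.ofReal (C * τ ^ (-2 : ℝ)) with hB
  have hBfin : B ≠ ⊤ := by
    have hint : IntegrableOn (fun τ : ℝ => C * τ ^ (-2 : ℝ)) (Ioi 1) :=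
      (integrableOn_Ioi_rpow_of_lt (by norm_num) one_pos).const_mul C
    exact (hint.lintegral_lt_top).ne
  refine ⟨a, 1 + B.toReal, ha0, min_le_right _ _, by positivity, fun E => ?_⟩
  rw [lintegral_eq_lintegral_meas_lt _ (ae_of_all _ fun y => by positivity)
    (hmeas E).aemeasurable,
    ENNReal.ofReal_add zero_le_one ENNReal.toReal_nonneg, ENNReal.ofReal_toReal hBfin,
    ← Ioc_union_Ioi_eq_Ioi (zero_le_one' ℝ)]
  refine (lintegral_union_le _ _ _).trans (add_le_add ?_ ?_)
  · calc _ ≤ ∫⁻ τ in Ioc (0 : ℝ) 1, 1 := lintegral_mono fun τ => by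
          refine (measure_mono (subset_univ _)).trans ?_
          simp
      _ = _ := by simp
  · refine setLIntegral_mono' measurableSet_Ioi fun τ hτ => ?_
    have hτ1 : (1 : ℝ) < τ := hτ
    have hτ0 : 0 < τ := one_pos.trans hτ1
    have hs0 : 0 < τ ^ (-a⁻¹) := by positivity
    have hs1 : τ ^ (-a⁻¹) ≤ 1 :=
      Real.rpow_le_one_of_one_le_of_nonpos hτ1.le (by simpa using ha0.le)
    rw [Measure.restrict_apply' measurableSet_Icc, inter_comm]
    refine (measure_mono (inter_subset_inter_right _ fun y hy => ?_)).trans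
      ((h E _ hs0 hs1).trans (ENNReal.ofReal_le_ofReal (mul_le_mul_of_nonneg_left ?_ hC)))
    · simp only [mem_ofPred_eq] at hy ⊢
      rcases (abs_nonneg (v y - E)).eq_or_lt with h0 | h0
      · rwa [← h0]
      · have := Real.rpow_lt_rpow_of_neg hτ0 hy (show -a⁻¹ < 0 by simpa using ha0)
        rwa [← Real.rpow_mul h0.le, neg_mul_neg, mul_inv_cancel₀ ha0.ne', Real.rpow_one] at this
    · rw [← Real.rpow_mul hτ0.le]
      refine Real.rpow_le_rpow_of_exponent_le hτ1.le ?_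
      rw [neg_mul, neg_le_neg_iff, inv_mul_eq_div, le_div_iff₀ ha0]
      linarith

/-- With `z = η/u`, subadditivity of `z ↦ z^a` gives `(1+z)^a ≤ 1 + z^a`, hence `a log(1+z) ≤ z^a`.
-/
theorem log_add_le {u η a : ℝ} (hu : 0 < u) (hη : 0 < η) (ha : 0 < a) (ha1 : a ≤ 1) :
    Real.log (u + η) ≤ Real.log u + η ^ a / a * u ^ (-a) := by
  have h1 : u + η = u * (1 + η / u) := by field_simp
  have hz : 0 < η / u := by positivity
  rw [h1, Real.log_mul hu.ne' (by positivity)]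
  have h2 : a * Real.log (1 + η / u) ≤ (η / u) ^ a := by
    rw [← Real.log_rpow (by positivity)]
    have h3 := Real.rpow_add_le_add_rpow zero_le_one hz.le ha.le ha1
    rw [Real.one_rpow] at h3
    have h4 := Real.log_le_log (by positivity) h3
    have h5 := Real.log_le_sub_one_of_pos (show 0 < 1 + (η / u) ^ a by positivity)
    linarith
  rw [Real.div_rpow hη.le hu.le] at h2
  rw [Real.rpow_neg hu.le]
  have : Real.log (1 + η / u) ≤ (η ^ a / u ^ a) / a := by rw [le_div_iff₀ ha]; linarith
  calc _ ≤ Real.log u + (η ^ a / u ^ a) / a := by linarith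
    _ = _ := by field_simp

theorem exists_integral_log_add_le {v : ℝ → ℝ} (hv : IsAnalyticOnTorus v)
    (hv' : Nonconstant v) : ∃ a C : ℝ, 0 < a ∧ 0 ≤ C ∧ ∀ E η : ℝ, 0 < η →
      ∫ y in (0 : ℝ)..1, Real.log (|v y - E| + η) ≤
        (∫ y in (0 : ℝ)..1, Real.log |v y - E|) + C * η ^ a := by
  obtain ⟨a, C, ha, ha1, hC, h⟩ := exists_lintegral_rpow_neg_le hv.2 hv'
  obtain ⟨κ, D, hκ, hD, hsub⟩ := sublevelBound_unitInterval hv.2 hv'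
  have hcont : Continuous v := continuous_iff_continuousAt.2 fun x => (hv.2 x).continuousAt
  refine ⟨a, C / a, ha, by positivity, fun E η hη => ?_⟩
  have hmeas : Measurable fun y => |v y - E| ^ (-a) :=
    (show Continuous fun y => |v y - E| by fun_prop).measurable.pow_const _
  have hint : IntegrableOn (fun y => |v y - E| ^ (-a)) (Icc 0 1) :=
    ⟨hmeas.aestronglyMeasurable, by
      rw [hasFiniteIntegral_iff_ofReal (ae_of_all _ fun y => by positivity)]
      exact (h E).trans_lt ENNReal.ofReal_lt_top⟩
  have hle : ∫ y in Icc (0 : ℝ) 1, |v y - E| ^ (-a) ≤ C := by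
    rw [integral_eq_lintegral_of_nonneg_ae (ae_of_all _ fun y => by positivity)
      hmeas.aestronglyMeasurable]
    exact ENNReal.toReal_le_of_le_ofReal hC (h E)
  -- At zeros of `v - E` both `Real.log 0` and `0 ^ (-a)` take the default value `0`, so the
  -- pointwise bound is used only off this null set.
  have hnull : volume (Icc (0 : ℝ) 1 ∩ {y | v y = E}) = 0 := by
    have hlim : Tendsto (fun s : ℝ => ENNReal.ofReal (D * s ^ κ)) (𝓝[>] 0) (𝓝 0) := by
      have : ContinuousAt (fun s : ℝ => ENNReal.ofReal (D * s ^ κ)) 0 :=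
        ENNReal.continuous_ofReal.continuousAt.comp
          (continuousAt_const.mul (Real.continuousAt_rpow_const 0 κ (Or.inr hκ.le)))
      have h0 := this.tendsto
      simp only [Real.zero_rpow hκ.ne', mul_zero, ENNReal.ofReal_zero] at h0
      exact h0.mono_left nhdsWithin_le_nhds
    refine le_antisymm (ge_of_tendsto hlim ?_) bot_le
    filter_upwards [Ioc_mem_nhdsGT (zero_lt_one' ℝ)] with s hs
    refine (measure_mono (inter_subset_inter_right _ fun y hy => ?_)).trans (hsub E s hs.1 hs.2)
    simp only [mem_ofPred_eq] at hy ⊢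
    simpa [hy] using hs.1
  have hlog := log_intervalIntegrable v hv E
  have hint' : IntervalIntegrable (fun y => |v y - E| ^ (-a)) volume 0 1 := by
    rw [intervalIntegrable_iff_integrableOn_Icc_of_le zero_le_one]; exact hint
  have hlog' : IntervalIntegrable (fun y => Real.log (|v y - E| + η)) volume 0 1 := by
    refine Continuous.intervalIntegrable ?_ _ _
    exact (show Continuous fun y => |v y - E| + η by fun_prop).log fun y =>
      (add_pos_of_nonneg_of_pos (abs_nonneg _) hη).ne'
  calc _ ≤ ∫ y in (0 : ℝ)..1, (Real.log |v y - E| + η ^ a / a * |v y - E| ^ (-a)) := by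
        refine intervalIntegral.integral_mono_ae_restrict zero_le_one hlog'
          (hlog.add (hint'.const_mul _)) ?_
        rw [EventuallyLE, ae_restrict_iff' measurableSet_Icc]
        have : ∀ᵐ y, y ∉ Icc (0 : ℝ) 1 ∩ {y | v y = E} := measure_eq_zero_iff_ae_notMem.1 hnull
        filter_upwards [this] with y hy hy1
        refine log_add_le (abs_pos.2 (sub_ne_zero.2 fun hE => hy ⟨hy1, hE⟩)) hη ha ha1
    _ = (∫ y in (0 : ℝ)..1, Real.log |v y - E|) +
          η ^ a / a * ∫ y in Icc (0 : ℝ) 1, |v y - E| ^ (-a) := by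
        rw [intervalIntegral.integral_add hlog (hint'.const_mul _),
          intervalIntegral.integral_const_mul, integral_Icc_eq_integral_Ioc,
          ← intervalIntegral.integral_of_le zero_le_one]
    _ ≤ _ := by
        have : η ^ a / a * ∫ y in Icc (0 : ℝ) 1, |v y - E| ^ (-a) ≤ η ^ a / a * C := by gcongr
        calc _ ≤ _ := add_le_add_right this _
          _ = _ := by ring

end

/-! ### Equidistribution of Diophantine orbits for Lipschitz functions. -/

section

open MeasureTheory Set Filter Topology

theorem isAnalyticOnTorus_lipschitz {v : ℝ → ℝ} (hv : IsAnalyticOnTorus v) :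
    ∃ L : ℝ, 0 ≤ L ∧ ∀ x y, |v x - v y| ≤ L * |x - y| := by
  have hcd : ContDiff ℝ 1 v := AnalyticOnNhd.contDiff fun x _ => hv.2 x
  have hdc : Continuous (deriv v) := hcd.continuous_deriv le_rfl
  have hper : Function.Periodic (deriv v) 1 := fun x => by
    rw [← deriv_comp_add_const]
    exact congrArg (fun f => deriv f x) (funext hv.1)
  obtain ⟨C, hC⟩ := isCompact_Icc.exists_bound_of_continuousOn (hdc.continuousOn (s := Icc 0 1))
  have hC0 : 0 ≤ C := (norm_nonneg _).trans (hC 0 (by simp))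
  have hb : ∀ x, ‖deriv v x‖ ≤ C := fun x => by
    obtain ⟨y, hy, hxy⟩ := hper.exists_mem_Ico₀ one_pos x
    rw [hxy]; exact hC y ⟨hy.1, hy.2.le⟩
  refine ⟨C, hC0, fun x y => ?_⟩
  have := lipschitzWith_of_nnnorm_deriv_le (C := ⟨C, hC0⟩)
    (hcd.differentiable one_ne_zero) (fun x => hb x)
  exact this.dist_le_mul x y

section Equidistribution

variable {f : ℝ → ℝ} {L : ℝ}

theorem continuous_of_abs_sub_le (hL : ∀ x y, |f x - f y| ≤ L * |x - y|) : Continuous f := by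
  have : LipschitzWith L.toNNReal f := LipschitzWith.of_dist_le_mul fun x y =>
    (hL x y).trans (mul_le_mul_of_nonneg_right (Real.le_coe_toNNReal L) (abs_nonneg _))
  exact this.continuous

/-- A Lipschitz function with a small period is close to its average. -/
theorem le_integral_add_of_periodic {q : ℕ} (hq : 0 < q) (hL0 : 0 ≤ L)
    (hL : ∀ x y, |f x - f y| ≤ L * |x - y|) (hper : Function.Periodic f ((q : ℝ)⁻¹)) (x : ℝ) :
    f x ≤ (∫ y in (0 : ℝ)..1, f y) + L / q := by
  have hcont := continuous_of_abs_sub_le hL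
  have hle : ∀ y, f x - L / q ≤ f y := fun y => by
    obtain ⟨z, hz, hxz⟩ := hper.exists_mem_Ico (by positivity : (0 : ℝ) < (q : ℝ)⁻¹) x y
    have h1 := (abs_le.1 (hL z y)).2
    have h2 : L * |z - y| ≤ L / q := by
      rw [div_eq_mul_inv]
      refine mul_le_mul_of_nonneg_left ?_ hL0
      rw [abs_of_nonneg (by linarith [hz.1])]
      linarith [hz.2]
    rw [hxz]; linarith
  have : ∫ y in (0 : ℝ)..1, (f x - L / q) ≤ ∫ y in (0 : ℝ)..1, f y :=
    intervalIntegral.integral_mono zero_le_one (by simp) (hcont.intervalIntegrable _ _) hle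
  simp at this
  linarith

/-- As a function of `x` the sum has periods `1` and `r`, hence `1/q` by Bézout, where `q = r.den`.
Its Lipschitz constant is `qL`, so it differs from its mean by at most `L`. -/
theorem sum_rational_orbit_le (hL0 : 0 ≤ L) (hL : ∀ x y, |f x - f y| ≤ L * |x - y|)
    (hper : Function.Periodic f 1) (r : ℚ) (x : ℝ) :
    ∑ n ∈ Finset.range r.den, f (x + n * r) ≤ r.den * (∫ y in (0 : ℝ)..1, f y) + L := by
  have hq : 0 < r.den := r.den_pos
  have hqR : (0 : ℝ) < r.den := by exact_mod_cast hq
  have hcont := continuous_of_abs_sub_le hL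
  set F : ℝ → ℝ := fun x => ∑ n ∈ Finset.range r.den, f (x + n * r) with hF
  have hper1 : Function.Periodic F 1 := fun x => by
    refine Finset.sum_congr rfl fun n _ => ?_
    rw [add_right_comm]; exact hper _
  have hden : (r.den : ℝ) * r = r.num := by exact_mod_cast Rat.den_mul_eq_num r
  have hperr : Function.Periodic F (r : ℝ) := fun x => by
    have h1 := Finset.sum_range_succ (fun n : ℕ => f (x + n * r)) r.den
    rw [Finset.sum_range_succ'] at h1
    have h2 : f (x + r.den * r) = f x := by
      rw [hden]; simpa using hper.int_mul r.num x
    simp only [hF]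
    simp only [h2, Nat.cast_zero, zero_mul, add_zero, Nat.cast_add, Nat.cast_one] at h1
    rw [← add_right_cancel h1]
    refine Finset.sum_congr rfl fun n _ => ?_
    congr 1; ring
  have hperq : Function.Periodic F ((r.den : ℝ)⁻¹) := by
    have hbez := Int.gcd_eq_gcd_ab r.num r.den
    have hg : Int.gcd r.num r.den = 1 := by
      have := r.reduced; simpa [Int.gcd, Nat.Coprime] using this
    rw [hg] at hbez
    set s := Int.gcdA r.num r.den
    set t := Int.gcdB r.num r.den
    have hbez' : (1 : ℝ) = r.num * s + r.den * t := by exact_mod_cast hbez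
    have : (r.den : ℝ)⁻¹ = s * (r : ℝ) + t * 1 := by
      rw [← hden] at hbez'
      field_simp
      linarith
    rw [this]
    exact (hperr.int_mul s).add_period (hper1.int_mul t)
  have hFL : ∀ x y, |F x - F y| ≤ (r.den * L) * |x - y| := fun x y => by
    simp only [hF]
    rw [← Finset.sum_sub_distrib]
    refine (Finset.abs_sum_le_sum_abs _ _).trans ?_
    calc _ ≤ ∑ n ∈ Finset.range r.den, L * |x - y| := Finset.sum_le_sum fun n _ => by
          refine (hL _ _).trans_eq ?_; congr 2; ring
      _ = _ := by simp; ring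
  have hint : ∫ y in (0 : ℝ)..1, F y = r.den * ∫ y in (0 : ℝ)..1, f y := by
    simp only [hF]
    rw [intervalIntegral.integral_finsetSum fun (n : ℕ) _ =>
      (show Continuous fun x => f (x + n * r) by fun_prop).intervalIntegrable _ _]
    rw [Finset.sum_congr rfl (g := fun _ => ∫ y in (0 : ℝ)..1, f y)]
    · simp
    · intro n _
      rw [intervalIntegral.integral_comp_add_right, zero_add, add_comm 1,
        hper.intervalIntegral_add_eq _ 0, zero_add]
  have := le_integral_add_of_periodic hq (by positivity) hFL hperq x
  rw [hint, mul_div_cancel_left₀ _ hqR.ne'] at this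
  exact this

/-- A Birkhoff sum whose length is the denominator of a good rational approximation. -/
theorem sum_orbit_le_of_near_rational (hL0 : 0 ≤ L) (hL : ∀ x y, |f x - f y| ≤ L * |x - y|)
    (hper : Function.Periodic f 1) {ω : ℝ} {r : ℚ} (hr : |ω - r| ≤ 1 / (r.den : ℝ) ^ 2) (x : ℝ) :
    ∑ n ∈ Finset.range r.den, f (x + n * ω) ≤ r.den * (∫ y in (0 : ℝ)..1, f y) + 2 * L := by
  have hqR : (0 : ℝ) < r.den := by exact_mod_cast r.den_pos
  have h1 := sum_rational_orbit_le hL0 hL hper r x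
  have h2 : ∑ n ∈ Finset.range r.den, f (x + n * ω) ≤
      ∑ n ∈ Finset.range r.den, (f (x + n * r) + L / r.den) := by
    refine Finset.sum_le_sum fun n hn => ?_
    have hn' : (n : ℝ) ≤ r.den := by exact_mod_cast (Finset.mem_range.1 hn).le
    have h3 := (abs_le.1 (hL (x + n * ω) (x + n * r))).2
    have h4 : |x + n * ω - (x + n * r)| ≤ 1 / r.den := by
      -- Each of the `q` points moves by at most `1/q`, so the total error is a further `L`.
      rw [show x + n * ω - (x + n * r) = n * (ω - r) by ring, abs_mul, Nat.abs_cast]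
      calc _ ≤ (r.den : ℝ) * (1 / (r.den : ℝ) ^ 2) := by gcongr
        _ = _ := by field_simp
    have h5 : L * |x + n * ω - (x + n * r)| ≤ L * (1 / r.den) := by gcongr
    rw [mul_one_div] at h5
    linarith
  rw [Finset.sum_add_distrib] at h2
  simp only [Finset.sum_const, Finset.card_range, nsmul_eq_mul, mul_div_cancel₀ L hqR.ne'] at h2
  linarith

/-- Dirichlet gives `‖qω‖ ≤ 1/Q` and the Diophantine condition gives `‖qω‖ ≥ t/q²`. The denominator
thus lies between bounds independent of `ω`, which makes equidistribution uniform in the frequency.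
-/
theorem exists_rat_of_mem_DC {t ω : ℝ} (hω : ω ∈ DC t) {Q : ℕ} (hQ : 0 < Q) :
    ∃ r : ℚ, |ω - r| ≤ 1 / (r.den : ℝ) ^ 2 ∧ r.den ≤ Q ∧ t * Q ≤ (r.den : ℝ) ^ 2 := by
  obtain ⟨r, hr, hrQ⟩ := Real.exists_rat_abs_sub_le_and_den_le ω hQ
  have hqR : (0 : ℝ) < r.den := by exact_mod_cast r.den_pos
  have hQR : (0 : ℝ) < Q := by exact_mod_cast hQ
  have hle : (r.den : ℝ) ≤ Q := by exact_mod_cast hrQ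
  refine ⟨r, hr.trans ?_, hrQ, ?_⟩
  · rw [pow_two]; gcongr; linarith
  · have h1 := hω r.den (by exact_mod_cast r.den_pos.ne')
    have hden : (r.den : ℝ) * r = r.num := by exact_mod_cast Rat.den_mul_eq_num r
    have h2 : torusNorm (((r.den : ℤ) : ℝ) * ω) ≤ 1 / Q := by
      refine (round_le _ r.num).trans ?_
      rw [← hden, Int.cast_natCast, ← mul_sub, abs_mul, Nat.abs_cast]
      calc _ ≤ (r.den : ℝ) * (1 / ((Q + 1) * r.den)) := by gcongr
        _ = 1 / (Q + 1) := by field_simp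
        _ ≤ _ := by gcongr; linarith
    have h3 := h1.trans h2
    rw [Int.cast_natCast, Nat.abs_cast, div_le_div_iff₀ (by positivity) hQR] at h3
    linarith

theorem le_integral_add_of_periodic_one (hL0 : 0 ≤ L) (hL : ∀ x y, |f x - f y| ≤ L * |x - y|)
    (hper : Function.Periodic f 1) (x : ℝ) : f x ≤ (∫ y in (0 : ℝ)..1, f y) + L := by
  have := le_integral_add_of_periodic one_pos hL0 hL (by simpa using hper) x
  simpa using this

theorem sum_orbit_mul_add_le {q : ℕ} {ω B : ℝ} (hL0 : 0 ≤ L)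
    (hL : ∀ x y, |f x - f y| ≤ L * |x - y|) (hper : Function.Periodic f 1)
    (h : ∀ x, ∑ n ∈ Finset.range q, f (x + n * ω) ≤ q * (∫ y in (0 : ℝ)..1, f y) + B)
    (m s : ℕ) (x : ℝ) :
    ∑ n ∈ Finset.range (q * m + s), f (x + n * ω) ≤
      ((q * m + s : ℕ) : ℝ) * (∫ y in (0 : ℝ)..1, f y) + m * B + s * L := by
  induction m generalizing x with
  | zero =>
    simp only [mul_zero, zero_add, Nat.cast_zero, zero_mul, add_zero]
    calc _ ≤ ∑ n ∈ Finset.range s, ((∫ y in (0 : ℝ)..1, f y) + L) :=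
          Finset.sum_le_sum fun n _ => le_integral_add_of_periodic_one hL0 hL hper _
      _ = _ := by simp
  | succ m ih =>
    rw [show q * (m + 1) + s = q + (q * m + s) by ring, Finset.sum_range_add]
    have h1 := h x
    have h2 := ih (x + q * ω)
    have h3 : ∀ n : ℕ, x + ((q + n : ℕ) : ℝ) * ω = x + q * ω + n * ω := fun n => by
      push_cast; ring
    simp only [h3]
    push_cast at h2 ⊢
    linarith

/-- Uniform equidistribution of the orbits of Diophantine rotations. -/
theorem exists_sum_orbit_le {L t δ : ℝ} (hL0 : 0 ≤ L) (ht : 0 < t) (hδ : 0 < δ) :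
    ∃ N₀ : ℕ, ∀ f : ℝ → ℝ, (∀ x y, |f x - f y| ≤ L * |x - y|) → Function.Periodic f 1 →
      ∀ ω ∈ DC t, ∀ N : ℕ, N₀ ≤ N → ∀ x : ℝ,
        ∑ n ∈ Finset.range N, f (x + n * ω) ≤ N * ((∫ y in (0 : ℝ)..1, f y) + δ) := by
  -- This `Q` forces `q ≥ 4L/δ`, so the full blocks cost at most `Nδ/2`; `N₀` makes the incomplete
  -- block, of length at most `Q`, cost at most `Nδ/2`.
  obtain ⟨Q, hQ⟩ := exists_nat_gt ((4 * L / δ) ^ 2 / t)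
  have hQR : (0 : ℝ) < Q := lt_of_le_of_lt (by positivity) hQ
  have hQ0 : 0 < Q := by exact_mod_cast hQR
  obtain ⟨N₀, hN₀⟩ := exists_nat_gt (2 * Q * L / δ)
  refine ⟨N₀, fun f hL hper ω hω N hN x => ?_⟩
  obtain ⟨r, hr, hrQ, hrt⟩ := exists_rat_of_mem_DC hω hQ0
  have hqR : (0 : ℝ) < r.den := by exact_mod_cast r.den_pos
  have hbig : 4 * L / δ ≤ r.den := by
    refine le_of_sq_le_sq ?_ hqR.le
    rw [div_lt_iff₀ ht] at hQ
    linarith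
  have h1 := sum_orbit_mul_add_le hL0 hL hper
    (sum_orbit_le_of_near_rational hL0 hL hper hr) (N / r.den) (N % r.den) x
  rw [Nat.div_add_mod] at h1
  refine h1.trans ?_
  have h2 : ((N / r.den : ℕ) : ℝ) * (2 * L) ≤ N * (δ / 2) := by
    have h3 : ((N / r.den : ℕ) : ℝ) ≤ N / r.den := Nat.cast_div_le
    rw [div_le_iff₀ hδ] at hbig
    calc _ ≤ (N / r.den : ℝ) * (2 * L) := by gcongr
      _ ≤ (N / r.den : ℝ) * (r.den * δ / 2) := by gcongr; linarith
      _ = _ := by field_simp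
  have h4 : ((N % r.den : ℕ) : ℝ) * L ≤ N * (δ / 2) := by
    have h5 : ((N % r.den : ℕ) : ℝ) ≤ Q := by
      exact_mod_cast (Nat.mod_lt N r.den_pos).le.trans hrQ
    have h6 : (N₀ : ℝ) ≤ N := by exact_mod_cast hN
    rw [div_lt_iff₀ hδ] at hN₀
    calc _ ≤ (Q : ℝ) * L := by gcongr
      _ ≤ (N₀ : ℝ) * (δ / 2) := by linarith
      _ ≤ _ := by gcongr
  linarith

end Equidistribution

theorem abs_log_add_sub_le {a b η : ℝ} (ha : 0 ≤ a) (hb : 0 ≤ b) (hη : 0 < η) :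
    |Real.log (a + η) - Real.log (b + η)| ≤ |a - b| / η := by
  have key : ∀ a b : ℝ, 0 ≤ a → 0 ≤ b →
      Real.log (a + η) - Real.log (b + η) ≤ |a - b| / η := fun a b ha hb => by
    rw [← Real.log_div (by positivity) (by positivity)]
    refine (Real.log_le_sub_one_of_pos (by positivity)).trans ?_
    have : (a + η) / (b + η) - 1 = (a - b) / (b + η) := by field_simp; ring
    rw [this]
    calc _ ≤ |a - b| / (b + η) := by gcongr; exact le_abs_self _
      _ ≤ _ := by gcongr; linarith
  rw [abs_le]
  constructor
  · have := key b a hb ha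
    rw [abs_sub_comm] at this; linarith
  · exact key a b ha hb

end

/-! ### Weighted row sums and decay of minors. -/

section

open Finset

/-- Expanding the product of row sums gives a sum over all maps `Fin m → Fin m`, among which the
permutations carry the Leibniz formula. -/
theorem norm_det_le_prod_sum {m : ℕ} (A : Matrix (Fin m) (Fin m) ℂ) :
    ‖A.det‖ ≤ ∏ i, ∑ j, ‖A i j‖ := by
  rw [← Matrix.det_transpose, Matrix.det_apply, Finset.prod_univ_sum, Fintype.piFinset_univ]
  calc _ ≤ ∑ τ : Equiv.Perm (Fin m), ∏ i, ‖A i (τ i)‖ := by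
        refine (norm_sum_le _ _).trans (sum_le_sum fun τ _ => ?_)
        rcases Int.units_eq_one_or (Equiv.Perm.sign τ) with h | h <;> simp [h]
    _ = ∑ f ∈ univ.image (fun τ : Equiv.Perm (Fin m) => (τ : Fin m → Fin m)),
          ∏ i, ‖A i (f i)‖ := by
        rw [sum_image fun τ _ τ' _ h => DFunLike.coe_injective h]
    _ ≤ _ := sum_le_sum_of_subset_of_nonneg (subset_univ _) fun f _ _ => by positivity

theorem map_omit1_univ {m : ℕ} (γ : Fin m) :
    univ.map (omit1 γ).toEmbedding = ({γ} : Finset (Fin m))ᶜ :=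
  Finset.map_orderEmbOfFin_univ _ _

theorem prod_omit1 {m : ℕ} (γ : Fin m) (R : Fin m → ℝ) :
    ∏ i, R (omit1 γ i) = ∏ i ∈ ({γ} : Finset (Fin m))ᶜ, R i := by
  rw [← map_omit1_univ, prod_map]; rfl

theorem sum_omit1 {m : ℕ} (γ : Fin m) (R : Fin m → ℝ) :
    ∑ i, R (omit1 γ i) = (∑ i, R i) - R γ := by
  rw [← sum_compl_add_sum {γ} R, ← map_omit1_univ, sum_map]
  simp

/-- A minor is bounded by the product of the row sums of a conjugated matrix. -/
theorem norm_minor_mul_exp_le {m : ℕ} (A : Matrix (Fin m) (Fin m) ℂ) (α α' : Fin m)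
    (w R : Fin m → ℝ) (hR : ∀ γ, ∑ γ', Real.exp (w γ - w γ') * ‖A γ γ'‖ ≤ R γ) :
    ‖minor A α α'‖ * Real.exp (w α' - w α) ≤ ∏ γ ∈ ({α} : Finset (Fin m))ᶜ, R γ := by
  set M := A.submatrix (omit1 α) (omit1 α') with hM
  -- The row weights omit `α` and the column weights omit `α'`, so in the determinant everything
  -- cancels except `e^{w α' - w α}`.
  set B : Matrix (Fin (m - 1)) (Fin (m - 1)) ℂ := Matrix.of fun i j =>
    ((Real.exp (w (omit1 α i)) : ℝ) : ℂ) *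
      Matrix.of (fun i j => ((Real.exp (-w (omit1 α' j)) : ℝ) : ℂ) * M i j) i j with hB
  have hdet : ‖B.det‖ = ‖minor A α α'‖ * Real.exp (w α' - w α) := by
    have e1 : ∏ i, Real.exp (w (omit1 α i)) = Real.exp ((∑ i, w i) - w α) := by
      rw [← Real.exp_sum, sum_omit1]
    have e2 : ∏ i, Real.exp (-w (omit1 α' i)) = Real.exp (-((∑ i, w i) - w α')) := by
      rw [← Real.exp_sum, sum_neg_distrib, sum_omit1]
    rw [hB, Matrix.det_mul_column, Matrix.det_mul_row, ← Complex.ofReal_prod,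
      ← Complex.ofReal_prod, e1, e2, norm_mul, norm_mul, Complex.norm_real, Complex.norm_real,
      Real.norm_of_nonneg (Real.exp_pos _).le, Real.norm_of_nonneg (Real.exp_pos _).le,
      ← mul_assoc, ← Real.exp_add, mul_comm]
    congr 2
    ring
  rw [← hdet, ← prod_omit1]
  refine (norm_det_le_prod_sum B).trans (prod_le_prod (fun i _ => by positivity) fun i _ => ?_)
  refine le_trans ?_ (hR (omit1 α i))
  calc _ = ∑ j, Real.exp (w (omit1 α i) - w (omit1 α' j)) * ‖A (omit1 α i) (omit1 α' j)‖ := by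
        refine sum_congr rfl fun j _ => ?_
        simp only [hB, hM, Matrix.of_apply, Matrix.submatrix_apply, norm_mul, Complex.norm_real,
          Real.norm_of_nonneg (Real.exp_pos _).le]
        rw [← mul_assoc, ← Real.exp_add, sub_eq_add_neg]
    _ ≤ _ := by
        rw [← sum_compl_add_sum {α'} (fun γ' => Real.exp (w (omit1 α i) - w γ') * _),
          ← map_omit1_univ, sum_map]
        refine le_add_of_nonneg_right (sum_nonneg fun _ _ => by positivity)

theorem sum_pow_natAbs_sub_le {r : ℝ} (hr0 : 0 ≤ r) (hr1 : r < 1) (N n : ℕ) :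
    ∑ k ∈ range N, r ^ ((n : ℤ) - k).natAbs ≤ 2 / (1 - r) := by
  have geom : ∀ s : Finset ℕ, ∑ k ∈ s, r ^ k ≤ 1 / (1 - r) := fun s => by
    rw [one_div, ← tsum_geometric_of_lt_one hr0 hr1]
    exact (summable_geometric_of_lt_one hr0 hr1).sum_le_tsum s fun _ _ => by positivity
  rw [← sum_filter_add_sum_filter_not (range N) (· ≤ n)]
  have h1 : ∑ k ∈ (range N).filter (· ≤ n), r ^ ((n : ℤ) - k).natAbs ≤ 1 / (1 - r) := by
    refine le_trans (le_of_eq ?_) (geom (((range N).filter (· ≤ n)).image (n - ·)))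
    rw [sum_image]
    · refine sum_congr rfl fun k hk => ?_
      congr 1
      have := (mem_filter.1 hk).2
      omega
    · intro a ha b hb hab
      have := (mem_filter.1 ha).2
      have := (mem_filter.1 hb).2
      simp only at hab
      omega
  have h2 : ∑ k ∈ (range N).filter (¬ · ≤ n), r ^ ((n : ℤ) - k).natAbs ≤ 1 / (1 - r) := by
    refine le_trans (le_of_eq ?_) (geom (((range N).filter (¬ · ≤ n)).image (· - n)))
    rw [sum_image]
    · refine sum_congr rfl fun k hk => ?_
      congr 1
      have := (mem_filter.1 hk).2
      omega
    · intro a ha b hb hab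
      have := (mem_filter.1 ha).2
      have := (mem_filter.1 hb).2
      simp only at hab
      omega
  calc _ ≤ 1 / (1 - r) + 1 / (1 - r) := add_le_add h1 h2
    _ = _ := by ring

theorem sum_exp_neg_mul_abs_sub_le {δ : ℝ} (hδ : 0 < δ) (hδ1 : δ ≤ 1) (N n : ℕ) :
    ∑ k ∈ range N, Real.exp (-δ * |(n : ℝ) - k|) ≤ 4 / δ := by
  have h : ∀ k : ℕ, Real.exp (-δ * |(n : ℝ) - k|) = Real.exp (-δ) ^ ((n : ℤ) - k).natAbs :=
    fun k => by
      rw [← Real.exp_nat_mul, Nat.cast_natAbs]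
      push_cast
      ring_nf
  simp only [h]
  refine (sum_pow_natAbs_sub_le (Real.exp_pos _).le (by simpa using hδ) N n).trans ?_
  have h1 : Real.exp (-δ) ≤ 1 / (1 + δ) := by
    rw [Real.exp_neg, ← one_div]
    exact one_div_le_one_div_of_le (by linarith) (by linarith [Real.add_one_le_exp δ])
  have h2 : δ / 2 ≤ 1 - Real.exp (-δ) := by
    have h3 : 1 - 1 / (1 + δ) = δ / (1 + δ) := by field_simp; ring
    have h4 : δ / 2 ≤ δ / (1 + δ) := by gcongr; linarith
    linarith
  calc _ ≤ 2 / (δ / 2) := by gcongr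
    _ = _ := by field_simp; norm_num

theorem norm_entry_le_opNorm {l : ℕ} (A : Matrix (Fin l) (Fin l) ℂ) (i j : Fin l) :
    ‖A i j‖ ≤ opNorm A := by
  have h1 := (Matrix.toEuclideanCLM (n := Fin l) (𝕜 := ℂ) A).le_opNorm (EuclideanSpace.single j 1)
  have h2 := PiLp.norm_apply_le
    (Matrix.toEuclideanCLM (n := Fin l) (𝕜 := ℂ) A (EuclideanSpace.single j 1)) i
  have h3 : (Matrix.toEuclideanCLM (n := Fin l) (𝕜 := ℂ) A (EuclideanSpace.single j 1)) i =
      A i j := by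
    simp [Matrix.ofLp_toEuclideanCLM]
  rw [h3] at h2
  rw [PiLp.norm_single, norm_one, mul_one] at h1
  exact h2.trans h1

theorem sum_fin_mul {N l : ℕ} (F : Fin N → Fin l → ℝ) :
    ∑ γ : Fin (N * l), F γ.divNat γ.modNat = ∑ n, ∑ j, F n j := by
  rw [← Fintype.sum_prod_type' F, ← finProdFinEquiv.symm.sum_comp]
  rfl

section RowSums

variable {l : ℕ} {v : Fin l → ℝ → ℝ} {W : ℤ → Matrix (Fin l) (Fin l) ℂ} {ρ ε : ℝ}

theorem norm_entry_dirichlet_sub_le (hε : 0 < ε)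
    (hW : ∀ k : ℤ, opNorm (W k) ≤ Real.exp (-ρ * |(k : ℝ)|)) (ω x E : ℝ) {N : ℕ}
    (γ γ' : Fin (N * l)) :
    ‖(dirichlet v W ε ω x N - (E : ℂ) • (1 : Matrix (Fin (N * l)) (Fin (N * l)) ℂ)) γ γ'‖ ≤
      ε * Real.exp (-ρ * |(site γ : ℝ) - site γ'|) +
        if γ = γ' then |v γ.modNat (x + site γ * ω) - E| else 0 := by
  have hw : ‖(ε : ℂ) * W (site γ - site γ') γ.modNat γ'.modNat‖ ≤
      ε * Real.exp (-ρ * |(site γ : ℝ) - site γ'|) := by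
    rw [norm_mul, Complex.norm_real, Real.norm_of_nonneg hε.le]
    have := (norm_entry_le_opNorm _ γ.modNat γ'.modNat).trans (hW (site γ - site γ'))
    rw [Int.cast_sub] at this
    gcongr
  by_cases h : γ = γ'
  · subst h
    have e : (dirichlet v W ε ω x N - (E : ℂ) • (1 : Matrix (Fin (N * l)) (Fin (N * l)) ℂ)) γ γ =
        (ε : ℂ) * W (site γ - site γ) γ.modNat γ.modNat +
          ((v γ.modNat (x + site γ * ω) - E : ℝ) : ℂ) := by
      simp [dirichlet, block]; ring
    rw [e, if_pos rfl]
    refine (norm_add_le _ _).trans (add_le_add hw ?_)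
    rw [Complex.norm_real, Real.norm_eq_abs]
  · have e : (dirichlet v W ε ω x N - (E : ℂ) • (1 : Matrix (Fin (N * l)) (Fin (N * l)) ℂ)) γ γ' =
        (ε : ℂ) * W (site γ - site γ') γ.modNat γ'.modNat := by
      have hne : site γ = site γ' → γ.modNat ≠ γ'.modNat := fun h1 h2 => h <| by
        refine finProdFinEquiv.symm.injective (Prod.ext (Fin.ext ?_) h2)
        exact Nat.cast_injective (add_right_cancel h1)
      by_cases h1 : site γ = site γ'
      · simp [dirichlet, block, h, h1, hne h1]
      · simp [dirichlet, block, h, h1]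
    rw [e, if_neg h, add_zero]
    exact hw

/-- Weights of slope at most `ρ - δ` leave decay `e^{-δ|n-n'|}`; its sum over sites is at most
`4/δ`, and each site carries `l` components. -/
theorem rowSum_dirichlet_le (hε : 0 < ε)
    (hW : ∀ k : ℤ, opNorm (W k) ≤ Real.exp (-ρ * |(k : ℝ)|)) {δ : ℝ} (hδ : 0 < δ) (hδ1 : δ ≤ 1)
    (ω x E : ℝ) {N : ℕ} (w : Fin (N * l) → ℝ)
    (hw : ∀ γ γ', w γ - w γ' ≤ (ρ - δ) * |(site γ : ℝ) - site γ'|) (γ : Fin (N * l)) :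
    ∑ γ', Real.exp (w γ - w γ') *
      ‖(dirichlet v W ε ω x N - (E : ℂ) • (1 : Matrix (Fin (N * l)) (Fin (N * l)) ℂ)) γ γ'‖ ≤
      |v γ.modNat (x + site γ * ω) - E| + 4 * l * (ε / δ) := by
  have h1 : ∀ γ', Real.exp (w γ - w γ') *
      ‖(dirichlet v W ε ω x N - (E : ℂ) • (1 : Matrix (Fin (N * l)) (Fin (N * l)) ℂ)) γ γ'‖ ≤
      ε * Real.exp (-δ * |(γ.divNat : ℕ) - ((γ'.divNat : ℕ) : ℝ)|) +
        if γ = γ' then |v γ.modNat (x + site γ * ω) - E| else 0 := fun γ' => by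
    refine (mul_le_mul_of_nonneg_left (norm_entry_dirichlet_sub_le hε hW ω x E γ γ')
      (Real.exp_pos _).le).trans ?_
    rw [mul_add]
    refine add_le_add ?_ ?_
    · rw [mul_left_comm, ← Real.exp_add]
      have h2 := hw γ γ'
      have h3 : (site γ : ℝ) - site γ' = (γ.divNat : ℕ) - ((γ'.divNat : ℕ) : ℝ) := by
        simp only [site, Int.cast_add, Int.cast_natCast, add_sub_add_right_eq_sub]
      rw [h3] at h2 ⊢
      gcongr
      linarith
    · split_ifs with h
      · subst h; simp
      · simp
  refine (sum_le_sum fun γ' _ => h1 γ').trans ?_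
  rw [sum_add_distrib, add_comm, sum_ite_eq, if_pos (mem_univ _), ← mul_sum]
  refine add_le_add le_rfl ?_
  rw [sum_fin_mul (fun n _ => Real.exp (-δ * |(γ.divNat : ℕ) - ((n : ℕ) : ℝ)|))]
  simp only [sum_const, card_univ, Fintype.card_fin, nsmul_eq_mul]
  rw [← mul_sum, Fin.sum_univ_eq_sum_range (fun n => Real.exp (-δ * |(γ.divNat : ℕ) - (n : ℝ)|))]
  have := sum_exp_neg_mul_abs_sub_le hδ hδ1 N γ.divNat
  calc _ ≤ ε * (l * (4 / δ)) := by gcongr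
    _ = _ := by ring

/-- Exponential off-diagonal decay of minors, with the product of the row sums as a factor. -/
theorem norm_minor_dirichlet_le (hε : 0 < ε)
    (hW : ∀ k : ℤ, opNorm (W k) ≤ Real.exp (-ρ * |(k : ℝ)|)) {δ : ℝ} (hδ : 0 < δ) (hδ1 : δ ≤ 1)
    (hδρ : δ ≤ ρ) (ω x E : ℝ) {N : ℕ} (α α' : Fin (N * l)) (hη : 0 < 4 * l * (ε / δ)) :
    ‖minor (dirichlet v W ε ω x N - (E : ℂ) • (1 : Matrix (Fin (N * l)) (Fin (N * l)) ℂ)) α α'‖ ≤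
      Real.exp ((∑ j, ∑ n ∈ range N,
        Real.log (|v j (x + ω + n * ω) - E| + 4 * l * (ε / δ))) - Real.log (4 * l * (ε / δ))) *
      Real.exp (-(ρ - δ) * |(site α : ℝ) - site α'|) := by
  set η : ℝ := 4 * l * (ε / δ) with hηdef
  set R : Fin (N * l) → ℝ := fun γ => |v γ.modNat (x + site γ * ω) - E| + η with hRdef
  have hRη : ∀ γ, η ≤ R γ := fun γ => le_add_of_nonneg_left (abs_nonneg _)
  have hR0 : ∀ γ, 0 < R γ := fun γ => hη.trans_le (hRη γ)
  -- The sign orients the weight so that it grows from `α` to `α'`.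
  obtain ⟨s, hs, hsα⟩ : ∃ s : ℝ, |s| = 1 ∧
      s * ((site α' : ℝ) - site α) = |(site α : ℝ) - site α'| := by
    rcases le_total (site α : ℝ) (site α') with h | h
    · exact ⟨1, by simp, by rw [abs_of_nonpos (by linarith)]; ring⟩
    · exact ⟨-1, by simp, by rw [abs_of_nonneg (by linarith)]; ring⟩
  have hβ : 0 ≤ ρ - δ := by linarith
  have h1 := norm_minor_mul_exp_le _ α α' (fun γ => (ρ - δ) * (s * site γ)) R
    (rowSum_dirichlet_le (v := v) hε hW hδ hδ1 ω x E _ fun γ γ' => by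
      rw [← mul_sub, ← mul_sub]
      refine mul_le_mul_of_nonneg_left ((le_abs_self _).trans ?_) hβ
      rw [abs_mul, hs, one_mul])
  rw [← mul_sub, ← mul_sub, hsα] at h1
  -- Every `R γ` is at least `η`, so restoring the deleted row costs only a factor `1/η`.
  have h2 : ∏ γ ∈ ({α} : Finset (Fin (N * l)))ᶜ, R γ ≤ (∏ γ, R γ) / η := by
    rw [le_div_iff₀ hη, ← prod_compl_mul_prod {α} R, prod_singleton]
    exact mul_le_mul_of_nonneg_left (hRη α) (prod_nonneg fun γ _ => (hR0 γ).le)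
  -- Sites start at `1` and `range N` at `0`, hence the base point `x + ω`.
  have h3 : ∏ γ, R γ = Real.exp (∑ j, ∑ n ∈ range N,
        Real.log (|v j (x + ω + n * ω) - E| + η)) := by
    rw [← Real.exp_log (prod_pos fun γ _ => hR0 γ), Real.log_prod fun γ _ => (hR0 γ).ne']
    congr 1
    rw [sum_comm]
    have h4 : ∀ γ : Fin (N * l), Real.log (R γ) =
        Real.log (|v γ.modNat (x + ω + (γ.divNat : ℕ) * ω) - E| + η) := fun γ => by
      simp only [hRdef, site]
      push_cast
      ring_nf
    rw [sum_congr rfl fun γ _ => h4 γ,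
      sum_fin_mul (fun n j => Real.log (|v j (x + ω + (n : ℕ) * ω) - E| + η)),
      Fin.sum_univ_eq_sum_range (fun n => ∑ j, Real.log (|v j (x + ω + (n : ℕ) * ω) - E| + η))]
  rw [Real.exp_sub, Real.exp_log hη, ← h3, neg_mul, Real.exp_neg, ← div_eq_mul_inv,
    le_div_iff₀ (Real.exp_pos _)]
  exact h1.trans h2

end RowSums

end

/-! ### Choice of constants and conclusion. -/

section

open MeasureTheory Filter Topology

theorem exists_integral_log_add_le_family {l : ℕ} {v : Fin l → ℝ → ℝ}
    (hv : ∀ j, IsAnalyticOnTorus (v j)) (hv' : ∀ j, Nonconstant (v j)) :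
    ∃ a C : ℝ, 0 < a ∧ a ≤ 1 ∧ 0 ≤ C ∧ ∀ (j : Fin l) (E η : ℝ), 0 < η → η ≤ 1 →
      ∫ y in (0 : ℝ)..1, Real.log (|v j y - E| + η) ≤
        (∫ y in (0 : ℝ)..1, Real.log |v j y - E|) + C * η ^ a := by
  choose a C ha hC h using fun j => exists_integral_log_add_le (hv j) (hv' j)
  obtain ⟨M, hM⟩ := Finite.exists_le fun j => (a j)⁻¹
  obtain ⟨C', hC'⟩ := Finite.exists_le C
  have hM1 : 1 ≤ max M 1 := le_max_right _ _
  refine ⟨(max M 1)⁻¹, max C' 0, by positivity, inv_le_one_of_one_le₀ hM1, le_max_right _ _,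
    -- A common exponent is obtained by lowering each `a j`, which only enlarges `η ^ a j` because
    -- `η ≤ 1`.
    fun j E η hη hη1 => (h j E η hη).trans ?_⟩
  have h1 : (max M 1)⁻¹ ≤ a j := inv_le_of_inv_le₀ (ha j) ((hM j).trans (le_max_left _ _))
  have h2 := Real.rpow_le_rpow_of_exponent_ge hη hη1 h1
  have h3 : C j ≤ max C' 0 := (hC' j).trans (le_max_left _ _)
  gcongr

theorem exists_small_coupling {a C l ρ : ℝ} (ha : 0 < a) (ha1 : a ≤ 1) (hl : 0 ≤ l) (hρ : 0 < ρ) :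
    ∃ ε₀ : ℝ, 0 < ε₀ ∧ ∀ ε : ℝ, 0 < ε → ε ≤ ε₀ →
      ε ^ (a / 4) ≤ 1 ∧ ε ^ (a / 4) ≤ ρ ∧ 4 * l * (ε / ε ^ (a / 4)) ≤ 1 ∧
        C * (4 * l * (ε / ε ^ (a / 4))) ^ a ≤ ε ^ (a / 4) / 3 := by
  have hlim : ∀ K b c : ℝ, 0 < b → 0 < c → ∀ᶠ ε : ℝ in 𝓝[>] 0, K * ε ^ b ≤ c := by
    intro K b c hb hc
    have h : ContinuousAt (fun ε : ℝ => K * ε ^ b) 0 :=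
      continuousAt_const.mul (Real.continuousAt_rpow_const 0 b (Or.inr hb.le))
    have h0 := h.tendsto
    simp only [Real.zero_rpow hb.ne', mul_zero] at h0
    exact (h0.mono_left nhdsWithin_le_nhds).eventually_le_const hc
  have hev := (hlim 1 (a / 4) 1 (by positivity) one_pos).and <|
    (hlim 1 (a / 4) ρ (by positivity) hρ).and <|
    (hlim (4 * l) (1 - a / 4) 1 (by linarith) one_pos).and
    -- The exponent compares `η^a` with `δ`; it equals `a(3 - a)/4`, positive since `a ≤ 1`.
    (hlim (C * (4 * l) ^ a) ((1 - a / 4) * a - a / 4) (1 / 3) (by nlinarith) (by norm_num))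
  obtain ⟨u, hu, hsub⟩ := mem_nhdsGT_iff_exists_Ioc_subset.1 hev
  refine ⟨u, hu, fun ε hε hεu => ?_⟩
  obtain ⟨h1, h2, h3, h4⟩ := hsub ⟨hε, hεu⟩
  have e : ε / ε ^ (a / 4) = ε ^ (1 - a / 4) := by rw [Real.rpow_sub hε, Real.rpow_one]
  rw [one_mul] at h1 h2
  refine ⟨h1, h2, by rwa [e], ?_⟩
  have hpos : 0 < ε ^ (a / 4) := by positivity
  rw [e, Real.mul_rpow (by positivity) (by positivity), ← Real.rpow_mul hε.le, ← mul_assoc]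
  rw [Real.rpow_sub hε, ← mul_div_assoc, div_le_iff₀ hpos] at h4
  linarith

theorem exists_sum_log_orbit_le {l : ℕ} {v : Fin l → ℝ → ℝ} (hv : ∀ j, IsAnalyticOnTorus (v j))
    {t δ η : ℝ} (ht : 0 < t) (hδ : 0 < δ) (hη : 0 < η) :
    ∃ N₀ : ℕ, ∀ ω ∈ DC t, ∀ N : ℕ, N₀ ≤ N → ∀ (j : Fin l) (x E : ℝ),
      ∑ n ∈ Finset.range N, Real.log (|v j (x + n * ω) - E| + η) ≤
        N * ((∫ y in (0 : ℝ)..1, Real.log (|v j y - E| + η)) + δ) := by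
  choose L hL0 hL using fun j => isAnalyticOnTorus_lipschitz (hv j)
  -- The Lipschitz constant `L j / η` does not involve `E`, so one `N₀` serves all energies.
  choose N₀ hN₀ using fun j => exists_sum_orbit_le (div_nonneg (hL0 j) hη.le) ht hδ
  obtain ⟨M, hM⟩ := Finite.exists_le N₀
  refine ⟨M, fun ω hω N hN j x E => ?_⟩
  refine hN₀ j (fun y => Real.log (|v j y - E| + η)) (fun y z => ?_) (fun y => ?_) ω hω N
    ((hM j).trans hN) x
  · refine (abs_log_add_sub_le (abs_nonneg _) (abs_nonneg _) hη).trans ?_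
    rw [div_mul_eq_mul_div]
    gcongr
    refine (abs_abs_sub_abs_le _ _).trans ?_
    rw [sub_sub_sub_cancel_right]
    exact hL j y z
  · simp only [(hv j).1 y]

end

end QPBlock

theorem mainTheorem2 (l : ℕ) (v : Fin l → ℝ → ℝ)
    (hv : ∀ j, QPBlock.IsAnalyticOnTorus (v j)) (hv' : ∀ j, QPBlock.Nonconstant (v j)) :
    ∃ σ : ℝ, 0 < σ ∧ ∀ ρ : ℝ, 0 < ρ →
      ∃ ε₀ : ℝ, 0 < ε₀ ∧ ∀ ε : ℝ, 0 < ε → ε ≤ ε₀ → ∀ t : ℝ, 0 < t →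
        ∃ N₀ : ℕ, ∀ ω ∈ QPBlock.DC t, ∀ W : ℤ → Matrix (Fin l) (Fin l) ℂ,
          (∀ k : ℤ, W (-k) = (W k).conjTranspose) →
          (∀ k : ℤ, QPBlock.opNorm (W k) ≤ Real.exp (-ρ * |(k : ℝ)|)) →
          ∀ N : ℕ, N₀ ≤ N → ∀ (x E : ℝ) (α α' : Fin (N * l)),
            ‖QPBlock.minor (QPBlock.dirichlet v W ε ω x N
                - (E : ℂ) • (1 : Matrix (Fin (N * l)) (Fin (N * l)) ℂ)) α α'‖ ≤
              Real.exp ((N : ℝ) *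
                ((∑ j : Fin l, ∫ y in (0 : ℝ)..1, Real.log |v j y - E|) + (l : ℝ) * ε ^ σ)) *
              Real.exp (-(ρ - ε ^ σ) * |(QPBlock.site α : ℝ) - (QPBlock.site α' : ℝ)|) := by
  rcases Nat.eq_zero_or_pos l with rfl | hl
  · exact ⟨1, one_pos, fun ρ _ => ⟨1, one_pos, fun ε _ _ t _ => ⟨0, fun ω _ W _ _ N _ x E α =>
      absurd α.2 (by simp)⟩⟩⟩
  have hl1 : (1 : ℝ) ≤ l := by exact_mod_cast hl
  obtain ⟨a, C, ha, ha1, hC, hint⟩ := QPBlock.exists_integral_log_add_le_family hv hv'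
  refine ⟨a / 4, by positivity, fun ρ hρ => ?_⟩
  obtain ⟨ε₀, hε₀, hsmall⟩ :=
    QPBlock.exists_small_coupling (C := C) ha ha1 (by positivity : (0 : ℝ) ≤ l) hρ
  refine ⟨ε₀, hε₀, fun ε hε hεε₀ t ht => ?_⟩
  obtain ⟨hδ1, hδρ, hη1, hCη⟩ := hsmall ε hε hεε₀
  have hδ : 0 < ε ^ (a / 4) := by positivity
  have hη : 0 < 4 * l * (ε / ε ^ (a / 4)) := by positivity
  set δ := ε ^ (a / 4)
  set η := 4 * l * (ε / δ) with hηdef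
  -- The allowance `lδ` per site is split in thirds: equidistribution, smoothing of the logarithm,
  -- and the term `-log η`, absorbed by `N ≥ N₂` and `l ≥ 1`.
  obtain ⟨N₁, hN₁⟩ := QPBlock.exists_sum_log_orbit_le hv ht (by positivity : 0 < δ / 3) hη
  obtain ⟨N₂, hN₂⟩ := exists_nat_ge (-Real.log η / (δ / 3))
  refine ⟨max N₁ N₂, fun ω hω W _ hW N hN x E α α' => ?_⟩
  refine (QPBlock.norm_minor_dirichlet_le hε hW hδ hδ1 hδρ ω x E α α' hη).trans ?_
  rw [← hηdef]
  gcongr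
  have h1 : ∀ j, ∑ n ∈ Finset.range N, Real.log (|v j (x + ω + n * ω) - E| + η) ≤
      N * ((∫ y in (0 : ℝ)..1, Real.log |v j y - E|) + 2 / 3 * δ) := fun j => by
    refine (hN₁ ω hω N ((le_max_left _ _).trans hN) j (x + ω) E).trans ?_
    have := hint j E η hη hη1
    exact mul_le_mul_of_nonneg_left (by linarith) N.cast_nonneg
  have h2 : -Real.log η ≤ N * (δ / 3) := by
    have h3 : (N₂ : ℝ) ≤ N := by exact_mod_cast (le_max_right _ _).trans hN
    rw [div_le_iff₀ (by positivity)] at hN₂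
    exact hN₂.trans (by gcongr)
  have h4 : (N : ℝ) * (δ / 3) ≤ N * (l * (δ / 3)) := by
    gcongr
    exact le_mul_of_one_le_left (by positivity) hl1
  have h5 := Finset.sum_le_sum fun j (_ : j ∈ Finset.univ) => h1 j
  rw [← Finset.mul_sum, Finset.sum_add_distrib] at h5
  simp only [Finset.sum_const, Finset.card_univ, Fintype.card_fin, nsmul_eq_mul] at h5
  linarith
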